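/- Let $\mathbb X,\mathbb E$ be finite-dimensional Euclidean spaces, let $\Phi:\mathbb X\to\mathbb E$ and $K:\mathbb X\to\mathbb R^m$ be linear, let $\mathcal J$ be a partition of $\{1,\dots,m\}$, and let $g(y)=\|y\|_{1,2}:=\sum_{J\in\mathcal J}\|y_J\|$ for $y\in\mathbb R^m$, where $y_J$ is the subvector of $y$ with indices in $J$ and $\|\cdot\|$ is the Euclidean norm. For $b\in\mathbb E$ and $\mu>0$ consider the problem $$P(b,\mu):\quad \min_{x\in\mathbb X}\ F_{b,\mu}(x):=\tfrac1{2\mu}\|\Phi x-b\|^2+g(Kx)$$ and its solution mapping $$S_{LS}(b,\mu):=\{x\in\mathbb X \mid 0\in\tfrac1\mu\Phi^*(\Phi x-b)+K^*\partial g(Kx)\}.$$ Here $\partial\varphi(x)=\{v\mid \varphi(u)-\varphi(x)\ge\langle v,u-x\rangle\ \forall u\}$, $\varphi^*(v)=\sup_x\{\langle v,x\rangle-\varphi(x)\}$ is the Fenchel conjugate, and $T_\Omega(z)=\{w\mid \exists\, t_k\to0,\ t_k>0,\ w_k\to w \text{ with } z+t_kw_k\in\Omega \text{ for all } k\}$ is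 the tangent cone. Let $\bar b\in\mathbb E$ and $\bar\mu>0$, let $\bar x$ be an optimal solution of $P(\bar b,\bar\mu)$, and let $\bar y\in\partial g(K\bar x)$ satisfy $K^*\bar y=-\frac1{\bar\mu}\Phi^*(\Phi\bar x-\bar b)$. Then the following are equivalent: (i) $S_{LS}$ has the isolated calmness property at $(\bar b,\bar\mu)$ for $\bar x$: $\bar x\in S_{LS}(\bar b,\bar\mu)$ and there are $\kappa>0$ and neighborhoods $U$ of $\bar x$, $V$ of $\bar b$ and $W\subset(0,\infty)$ of $\bar\mu$ such that $\|x-\bar x\|\le\kappa(\|b-\bar b\|+|\mu-\bar\mu|)$ whenever $b\in V$, $\mu\in W$ and $x\in S_{LS}(b,\mu)\cap U$. (ii) $\bar x$ is the unique optimal solution of $P(\bar b,\bar\mu)$. (ii$'$) $\bar x$ is a strong solution of $P(\bar b,\bar\mu)$: $\bar x$ is optimal and there are $c,\varepsilon>0$ such that $F_{\bar b,\bar\mu}(x)\ge F_{\bar b,\bar\mu}(\bar x)+\frac c2\|x-\bar x\|^2$ whenever $\|x-\bar x\|<\varepsilon$. (iii) $\operatorname{Ker}\Phi\cap K^{-1}\big(T_{\partial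 g^*(\bar y)}(K\bar x)\big)=\{0\}$. -/

import Mathlib

open Filter Topology

namespace GroupLasso

noncomputable section

section ConvexAnalysis

variable {V : Type*} [NormedAddCommGroup V] [InnerProductSpace ℝ V]

/-- The convex subdifferential of `φ : V → ℝ ∪ {∞}` at `x`:
all `v` with `φ u - φ x ≥ ⟪v, u - x⟫` for every `u`, written without subtraction in `EReal`. -/
def subdifferential (φ : V → EReal) (x : V) : Set V :=
  {v | ∀ u, φ x + ((inner ℝ v (u - x) : ℝ) : EReal) ≤ φ u}

/-- The Fenchel conjugate `φ* v = sup_x (⟪v, x⟫ - φ x)`. -/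
def fenchelConjugate (φ : V → EReal) (v : V) : EReal :=
  ⨆ x, (((inner ℝ v x : ℝ) : EReal) - φ x)

/-- The (Bouligand/Severi) tangent cone to `Ω` at `x`: all limits of sequences `w k` such that
`x + t k • w k ∈ Ω` for some positive `t k → 0`. -/
def tangentCone (Ω : Set V) (x : V) : Set V :=
  {w | ∃ (t : ℕ → ℝ) (z : ℕ → V), (∀ k, 0 < t k) ∧ Tendsto t atTop (𝓝 0) ∧
    Tendsto z atTop (𝓝 w) ∧ ∀ k, x + t k • z k ∈ Ω}

/-- The set of (global) minimizers of `F`. -/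
def argmin (F : V → ℝ) : Set V :=
  {x | ∀ u, F x ≤ F u}

/-- `x` is a strong solution (of order two) of the problem of minimizing `F`. -/
def IsStrongSolution (F : V → ℝ) (x : V) : Prop :=
  x ∈ argmin F ∧ ∃ c > (0 : ℝ), ∃ ε > (0 : ℝ), ∀ u ∈ Metric.ball x ε,
    F x + c / 2 * ‖u - x‖ ^ 2 ≤ F u

end ConvexAnalysis

section Regularizer

variable {m : ℕ}

/-- The subvector `y_J` of `y ∈ ℝ^m` with index set `J`, in `ℝ^J` with the Euclidean norm. -/
def subvector (y : EuclideanSpace ℝ (Fin m)) (J : Finset (Fin m)) : EuclideanSpace ℝ J :=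
  WithLp.toLp 2 fun j => y j

/-- The group Lasso regularizer `‖y‖_{1,2} = ∑_{J ∈ 𝒥} ‖y_J‖` of a partition `𝒥` of the
index set. -/
def groupLasso (𝒥 : Finpartition (Finset.univ : Finset (Fin m)))
    (y : EuclideanSpace ℝ (Fin m)) : ℝ :=
  ∑ J ∈ 𝒥.parts, ‖subvector y J‖

/-- The group Lasso regularizer as an extended-real-valued function. -/
def groupLassoE (𝒥 : Finpartition (Finset.univ : Finset (Fin m)))
    (y : EuclideanSpace ℝ (Fin m)) : EReal :=
  ((groupLasso 𝒥 y : ℝ) : EReal)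

end Regularizer

section LeastSquares

variable {X E : Type*} [NormedAddCommGroup X] [InnerProductSpace ℝ X] [FiniteDimensional ℝ X]
  [NormedAddCommGroup E] [InnerProductSpace ℝ E] [FiniteDimensional ℝ E] {m : ℕ}

/-- The objective `x ↦ (1 / (2 μ)) ‖Φ x - b‖² + ‖K x‖_{1,2}` of the problem `P(b, μ)`. -/
def objective (Φ : X →ₗ[ℝ] E) (K : X →ₗ[ℝ] EuclideanSpace ℝ (Fin m))
    (𝒥 : Finpartition (Finset.univ : Finset (Fin m))) (b : E) (μ : ℝ) (x : X) : ℝ :=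
  1 / (2 * μ) * ‖Φ x - b‖ ^ 2 + groupLasso 𝒥 (K x)

/-- The solution mapping `S_LS(b, μ) = {x | 0 ∈ (1/μ) Φ* (Φ x - b) + K* ∂g(K x)}` with
`g = ‖·‖_{1,2}`. -/
def solutionMap (Φ : X →ₗ[ℝ] E) (K : X →ₗ[ℝ] EuclideanSpace ℝ (Fin m))
    (𝒥 : Finpartition (Finset.univ : Finset (Fin m))) (b : E) (μ : ℝ) : Set X :=
  {x | ∃ y ∈ subdifferential (groupLassoE 𝒥) (K x),
    (1 / μ) • LinearMap.adjoint Φ (Φ x - b) + LinearMap.adjoint K y = 0}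

/-- Isolated calmness of a set-valued mapping `S`, with parameters `b` and `μ > 0`, at
`(b₀, μ₀)` for `x₀`. -/
def IsolatedCalmAt (S : E → ℝ → Set X) (b₀ : E) (μ₀ : ℝ) (x₀ : X) : Prop :=
  x₀ ∈ S b₀ μ₀ ∧ ∃ κ > (0 : ℝ), ∃ U ∈ 𝓝 x₀, ∃ V ∈ 𝓝 b₀, ∃ W ∈ 𝓝 μ₀,
    ∀ b ∈ V, ∀ μ ∈ W, 0 < μ → ∀ x ∈ S b μ ∩ U, ‖x - x₀‖ ≤ κ * (‖b - b₀‖ + |μ - μ₀|)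

end LeastSquares

end

end GroupLasso

/-! Write `g` for the regularizer and call `g - ⟪y₀, ·⟫ ≥ 0` the gap. The certificate `y₀` absorbs
the linear term of the least-squares part, so the objective at `x` exceeds its value at `x₀` by
exactly `1/(2μ₀) ‖Φ(x - x₀)‖²` plus the gap at `K x` (`objective_eq_add`). The zero set of the gap
is `∂g*(y₀)`.

The crux is a property of Euclidean norms that replaces polyhedrality: if the gap is `o(t²)` along a
sequence approaching its zero set in direction `v`, then it vanishes on a whole segment in direction
`v` (`exists_pos_forall_inner_eq_groupLasso`). Thus tangent directions to `∂g*(y₀)` are feasible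
directions, and failure of quadratic growth yields, by compactness, a nonzero element of the cone in
(iii).

The cycle is closed by the subgradient inequality (strong solution to calmness) and by convexity
(calmness to uniqueness). -/

namespace GroupLasso

/-! ### The gap of a single Euclidean norm -/

section Block

variable {H : Type*} [NormedAddCommGroup H] [InnerProductSpace ℝ H]

/-- Equality case of Cauchy–Schwarz: `‖p - ‖p‖ • a‖²` expands to `‖p‖² (‖a‖² - 1) ≤ 0`. -/
lemma eq_norm_smul_of_inner_eq_norm {a p : H} (ha : ‖a‖ ≤ 1) (hp : inner ℝ a p = ‖p‖) :
    p = ‖p‖ • a := by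
  have h : ‖p - ‖p‖ • a‖ ^ 2 ≤ 0 := by
    rw [norm_sub_sq_real, inner_smul_right, real_inner_comm, hp, norm_smul, norm_norm]
    have h1 : ‖a‖ ^ 2 ≤ 1 := pow_le_one₀ (norm_nonneg _) ha
    nlinarith [mul_le_mul_of_nonneg_left h1 (sq_nonneg ‖p‖)]
  exact sub_eq_zero.1 (norm_eq_zero.1 (pow_eq_zero_iff two_ne_zero |>.1
    (le_antisymm h (sq_nonneg _))))

lemma inner_le_norm_of_norm_le_one {a : H} (ha : ‖a‖ ≤ 1) (p : H) : inner ℝ a p ≤ ‖p‖ :=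
  (real_inner_le_norm a p).trans (mul_le_of_le_one_left (norm_nonneg p) ha)

/-- If the gap `‖·‖ - ⟪a, ·⟫` vanishes at `p` and is of order `o(t²)` along `p + t k • v k` with
`v k → v`, then it vanishes at `p + s • v` for all small `s ≥ 0`. -/
lemma exists_pos_forall_inner_eq_norm {a p v : H} (ha : ‖a‖ ≤ 1) (hp : inner ℝ a p = ‖p‖)
    {t : ℕ → ℝ} {w : ℕ → H} (ht : ∀ k, 0 < t k) (ht0 : Tendsto t atTop (𝓝 0))
    (hw : Tendsto w atTop (𝓝 v))
    (hgap : Tendsto (fun k => (‖p + t k • w k‖ - inner ℝ a (p + t k • w k)) / t k ^ 2)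
      atTop (𝓝 0)) :
    ∃ δ > (0 : ℝ), ∀ s, 0 ≤ s → s ≤ δ → inner ℝ a (p + s • v) = ‖p + s • v‖ := by
  by_cases hp0 : p = 0
  · subst hp0
    refine ⟨1, one_pos, fun s hs _ => ?_⟩
    -- At `p = 0` the gap is positively homogeneous, so dividing by `t k` alone already gives the
    -- gap of `w k`.
    have h1 : Tendsto (fun k => ‖w k‖ - inner ℝ a (w k)) atTop (𝓝 (‖v‖ - inner ℝ a v)) :=
      hw.norm.sub (tendsto_const_nhds.inner hw)
    have h2 : Tendsto (fun k => ‖w k‖ - inner ℝ a (w k)) atTop (𝓝 (0 * 0)) := by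
      refine (ht0.mul hgap).congr fun k => ?_
      have := (ht k).ne'
      simp only [zero_add, norm_smul, inner_smul_right, Real.norm_of_nonneg (ht k).le]
      field_simp
    have h3 := tendsto_nhds_unique h1 h2
    simp only [zero_add, norm_smul, inner_smul_right, Real.norm_of_nonneg hs]
    rw [show inner ℝ a v = ‖v‖ by linarith]
  · have hpos : 0 < ‖p‖ := norm_pos_iff.2 hp0
    have hpa := eq_norm_smul_of_inner_eq_norm ha hp
    have ha1 : ‖a‖ = 1 := by
      refine le_antisymm ha ?_
      have := real_inner_le_norm a p
      rw [hp] at this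
      by_contra! h
      nlinarith
    have haa : inner ℝ a a = (1 : ℝ) := by rw [real_inner_self_eq_norm_sq, ha1, one_pow]
    have hz : Tendsto (fun k => p + t k • w k) atTop (𝓝 p) := by
      simpa using tendsto_const_nhds.add (ht0.smul hw)
    -- For unit `a`, the squared component of `z` orthogonal to `a` is `(‖z‖ - ⟪a, z⟫)(‖z‖ + ⟪a,
    -- z⟫)`. As `p` is parallel to `a`, at `z = p + t k • w k` it equals `t k ^ 2` times that of `w
    -- k`; hence `v` is a multiple of `a`.
    have h1 : Tendsto (fun k => ‖w k - (inner ℝ a (w k) : ℝ) • a‖ ^ 2) atTop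
        (𝓝 (‖v - (inner ℝ a v : ℝ) • a‖ ^ 2)) :=
      (hw.sub ((tendsto_const_nhds.inner hw).smul tendsto_const_nhds)).norm.pow 2
    have h2 : Tendsto (fun k => ‖w k - (inner ℝ a (w k) : ℝ) • a‖ ^ 2) atTop
        (𝓝 (0 * (‖p‖ + inner ℝ a p))) := by
      refine (hgap.mul (hz.norm.add (tendsto_const_nhds.inner hz))).congr fun k => ?_
      have htk := (ht k).ne'
      have hperp : ∀ z : H, ‖z - (inner ℝ a z : ℝ) • a‖ ^ 2 = ‖z‖ ^ 2 - (inner ℝ a z) ^ 2 := by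
        intro z
        rw [norm_sub_sq_real, inner_smul_right, real_inner_comm a z, norm_smul, ha1, mul_one,
          Real.norm_eq_abs, sq_abs]
        ring
      have hsc : (p + t k • w k) - (inner ℝ a (p + t k • w k) : ℝ) • a
          = t k • (w k - (inner ℝ a (w k) : ℝ) • a) := by
        rw [inner_add_right, inner_smul_right, hp, add_smul, ← hpa, smul_sub, smul_smul]
        abel
      have h4 := hperp (p + t k • w k)
      rw [hsc, norm_smul, mul_pow, Real.norm_eq_abs, sq_abs] at h4
      rw [div_mul_eq_mul_div, div_eq_iff (pow_ne_zero 2 htk)]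
      linear_combination -h4
    have h3 := tendsto_nhds_unique h1 h2
    rw [zero_mul, sq_eq_zero_iff, norm_eq_zero, sub_eq_zero] at h3
    set l : ℝ := inner ℝ a v
    refine ⟨‖p‖ / (|l| + 1), by positivity, fun s hs hsd => ?_⟩
    rw [le_div_iff₀ (by positivity)] at hsd
    have hnn : 0 ≤ ‖p‖ + s * l := by
      nlinarith [mul_le_mul_of_nonneg_left (neg_abs_le l) hs]
    have hps : p + s • v = (‖p‖ + s * l) • a := by
      rw [add_smul, ← hpa, mul_smul, ← h3]
    rw [hps, inner_smul_right, haa, norm_smul, ha1, Real.norm_of_nonneg hnn]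

end Block

/-! ### Conjugate, subdifferentials and tangent directions of the regularizer -/

section Regularizer

variable {m : ℕ} {𝒥 : Finpartition (Finset.univ : Finset (Fin m))}

lemma subvector_add (y z : EuclideanSpace ℝ (Fin m)) (J : Finset (Fin m)) :
    subvector (y + z) J = subvector y J + subvector z J := rfl

lemma subvector_smul (s : ℝ) (y : EuclideanSpace ℝ (Fin m)) (J : Finset (Fin m)) :
    subvector (s • y) J = s • subvector y J := rfl

lemma continuous_subvector (J : Finset (Fin m)) :
    Continuous fun y : EuclideanSpace ℝ (Fin m) => subvector y J := by
  unfold subvector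
  fun_prop

lemma inner_eq_sum_subvector (𝒥 : Finpartition (Finset.univ : Finset (Fin m)))
    (y z : EuclideanSpace ℝ (Fin m)) :
    inner ℝ y z = ∑ J ∈ 𝒥.parts, inner ℝ (subvector y J) (subvector z J) := by
  have h (J : Finset (Fin m)) :
      inner ℝ (subvector y J) (subvector z J) = ∑ i ∈ J, inner ℝ (y i) (z i) := by
    rw [PiLp.inner_apply, ← Finset.sum_coe_sort J]
    rfl
  simp_rw [h]
  rw [PiLp.inner_apply, ← Finset.sum_biUnion (t := fun J => J) 𝒥.disjoint]
  exact Finset.sum_congr 𝒥.biUnion_parts.symm fun _ _ => rfl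

lemma groupLasso_smul {s : ℝ} (hs : 0 ≤ s) (y : EuclideanSpace ℝ (Fin m)) :
    groupLasso 𝒥 (s • y) = s * groupLasso 𝒥 y := by
  simp only [groupLasso, subvector_smul, norm_smul, Real.norm_of_nonneg hs, Finset.mul_sum]

lemma groupLasso_add_le (y z : EuclideanSpace ℝ (Fin m)) :
    groupLasso 𝒥 (y + z) ≤ groupLasso 𝒥 y + groupLasso 𝒥 z := by
  simp only [groupLasso, subvector_add, ← Finset.sum_add_distrib]
  exact Finset.sum_le_sum fun J _ => norm_add_le _ _

lemma mem_subdifferential_groupLassoE {y z : EuclideanSpace ℝ (Fin m)} :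
    y ∈ subdifferential (groupLassoE 𝒥) z ↔
      (∀ u, inner ℝ y u ≤ groupLasso 𝒥 u) ∧ inner ℝ y z = groupLasso 𝒥 z := by
  have key : y ∈ subdifferential (groupLassoE 𝒥) z ↔
      ∀ u, groupLasso 𝒥 z + inner ℝ y (u - z) ≤ groupLasso 𝒥 u := by
    simp only [subdifferential, groupLassoE, Set.mem_ofPred_eq]
    exact forall_congr' fun u => by rw [← EReal.coe_add, EReal.coe_le_coe_iff]
  rw [key]
  constructor
  · intro h
    -- By positive homogeneity, testing at `0` and `2z` gives the two inequalities of `⟪y, z⟫ = g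
    -- z`.
    have h0 := h ((0 : ℝ) • z)
    have h2 := h ((2 : ℝ) • z)
    rw [groupLasso_smul le_rfl, inner_sub_right, inner_smul_right] at h0
    rw [groupLasso_smul zero_le_two, inner_sub_right, inner_smul_right] at h2
    have heq : inner ℝ y z = groupLasso 𝒥 z := by linarith
    refine ⟨fun u => ?_, heq⟩
    have := h u
    rw [inner_sub_right] at this
    linarith
  · rintro ⟨h, heq⟩ u
    rw [inner_sub_right, heq]
    linarith [h u]

/-- The vector obtained from `y` by rescaling each block `y_J` by `c J`. -/
def rescale (𝒥 : Finpartition (Finset.univ : Finset (Fin m))) (c : Finset (Fin m) → ℝ)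
    (y : EuclideanSpace ℝ (Fin m)) : EuclideanSpace ℝ (Fin m) :=
  WithLp.toLp 2 fun i => c (𝒥.part i) * y i

lemma subvector_rescale (c : Finset (Fin m) → ℝ) (y : EuclideanSpace ℝ (Fin m))
    {J : Finset (Fin m)} (hJ : J ∈ 𝒥.parts) :
    subvector (rescale 𝒥 c y) J = c J • subvector y J := by
  ext i
  simp [subvector, rescale, 𝒥.part_eq_of_mem hJ i.2]

lemma forall_inner_le_groupLasso_iff {y : EuclideanSpace ℝ (Fin m)} :
    (∀ u, inner ℝ y u ≤ groupLasso 𝒥 u) ↔ ∀ J ∈ 𝒥.parts, ‖subvector y J‖ ≤ 1 := by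
  constructor
  · intro h J hJ
    -- The test vector is `y` with every block but `J` set to zero.
    have h1 := h (rescale 𝒥 (fun I => if I = J then 1 else 0) y)
    rw [inner_eq_sum_subvector 𝒥, groupLasso, Finset.sum_eq_single_of_mem J hJ,
      Finset.sum_eq_single_of_mem J hJ, subvector_rescale _ _ hJ, if_pos rfl, one_smul,
      real_inner_self_eq_norm_sq] at h1
    · by_contra! h2
      nlinarith
    · intro I hI hIJ
      rw [subvector_rescale _ _ hI, if_neg hIJ, zero_smul, norm_zero]
    · intro I hI hIJ
      rw [subvector_rescale _ _ hI, if_neg hIJ, zero_smul, inner_zero_right]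
  · intro h u
    rw [inner_eq_sum_subvector 𝒥]
    exact Finset.sum_le_sum fun J hJ => inner_le_norm_of_norm_le_one (h J hJ) _

lemma groupLasso_sub_inner (y z : EuclideanSpace ℝ (Fin m)) :
    groupLasso 𝒥 z - inner ℝ y z
      = ∑ J ∈ 𝒥.parts, (‖subvector z J‖ - inner ℝ (subvector y J) (subvector z J)) := by
  rw [inner_eq_sum_subvector 𝒥, groupLasso, Finset.sum_sub_distrib]

lemma inner_subvector_eq_norm {y z : EuclideanSpace ℝ (Fin m)}
    (hy : ∀ u, inner ℝ y u ≤ groupLasso 𝒥 u) (hz : inner ℝ y z = groupLasso 𝒥 z)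
    {J : Finset (Fin m)} (hJ : J ∈ 𝒥.parts) :
    inner ℝ (subvector y J) (subvector z J) = ‖subvector z J‖ := by
  have h := groupLasso_sub_inner (𝒥 := 𝒥) y z
  rw [hz, sub_self, eq_comm, Finset.sum_eq_zero_iff_of_nonneg fun I hI => sub_nonneg.2
    (inner_le_norm_of_norm_le_one (forall_inner_le_groupLasso_iff.1 hy I hI) _)] at h
  linarith [h J hJ]

lemma exists_inner_eq_groupLasso (z : EuclideanSpace ℝ (Fin m)) :
    ∃ u : EuclideanSpace ℝ (Fin m), (∀ v, inner ℝ u v ≤ groupLasso 𝒥 v) ∧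
      inner ℝ u z = groupLasso 𝒥 z := by
  -- Normalize each block; zero blocks stay zero.
  refine ⟨rescale 𝒥 (fun J => ‖subvector z J‖⁻¹) z, ?_, ?_⟩
  · rw [forall_inner_le_groupLasso_iff]
    intro J hJ
    rw [subvector_rescale _ _ hJ, norm_smul, norm_inv, norm_norm]
    exact inv_mul_le_one
  · rw [inner_eq_sum_subvector 𝒥, groupLasso]
    refine Finset.sum_congr rfl fun J hJ => ?_
    rw [subvector_rescale _ _ hJ, real_inner_smul_left, real_inner_self_eq_norm_sq]
    by_cases h : ‖subvector z J‖ = 0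
    · simp [h]
    · field_simp

lemma fenchelConjugate_groupLassoE_eq_zero {y : EuclideanSpace ℝ (Fin m)}
    (hy : ∀ u, inner ℝ y u ≤ groupLasso 𝒥 u) : fenchelConjugate (groupLassoE 𝒥) y = 0 := by
  refine le_antisymm (iSup_le fun u => ?_) ?_
  · rw [groupLassoE, ← EReal.coe_sub, ← EReal.coe_zero, EReal.coe_le_coe_iff]
    linarith [hy u]
  · refine le_iSup_of_le ((0 : ℝ) • (0 : EuclideanSpace ℝ (Fin m))) ?_
    rw [groupLassoE, groupLasso_smul le_rfl, ← EReal.coe_sub, ← EReal.coe_zero,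
      EReal.coe_le_coe_iff]
    simp

/-- Since `g*` vanishes on the dual ball, a subgradient `z` at `y` makes `⟪·, z⟫` maximal there at
`y`, and that maximum is `g z`. -/
lemma mem_subdifferential_fenchelConjugate {y z : EuclideanSpace ℝ (Fin m)}
    (hy : ∀ u, inner ℝ y u ≤ groupLasso 𝒥 u) :
    z ∈ subdifferential (fenchelConjugate (groupLassoE 𝒥)) y ↔
      inner ℝ y z = groupLasso 𝒥 z := by
  simp only [subdifferential, Set.mem_ofPred_eq, fenchelConjugate_groupLassoE_eq_zero hy, zero_add]
  constructor
  · intro h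
    obtain ⟨u, hu, huz⟩ := exists_inner_eq_groupLasso (𝒥 := 𝒥) z
    have h1 := h u
    rw [fenchelConjugate_groupLassoE_eq_zero hu, ← EReal.coe_zero, EReal.coe_le_coe_iff,
      inner_sub_right, real_inner_comm, huz, real_inner_comm] at h1
    linarith [hy z]
  · intro h u
    refine le_iSup_of_le z ?_
    rw [groupLassoE, ← EReal.coe_sub, EReal.coe_le_coe_iff, inner_sub_right, real_inner_comm,
      real_inner_comm y z, h]

/-- If the gap `g - ⟪y, ·⟫` of the regularizer `g` vanishes at `z₀` and is of order `o(t²)` along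
`z₀ + t k • w k` with `w k → v`, then it vanishes at `z₀ + s • v` for all small `s ≥ 0`. -/
lemma exists_pos_forall_inner_eq_groupLasso {y z₀ v : EuclideanSpace ℝ (Fin m)}
    (hy : ∀ u, inner ℝ y u ≤ groupLasso 𝒥 u) (hz₀ : inner ℝ y z₀ = groupLasso 𝒥 z₀)
    {t : ℕ → ℝ} {w : ℕ → EuclideanSpace ℝ (Fin m)} (ht : ∀ k, 0 < t k)
    (ht0 : Tendsto t atTop (𝓝 0)) (hw : Tendsto w atTop (𝓝 v))
    (hgap : Tendsto (fun k => (groupLasso 𝒥 (z₀ + t k • w k) - inner ℝ y (z₀ + t k • w k))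
      / t k ^ 2) atTop (𝓝 0)) :
    ∃ δ > (0 : ℝ), ∀ s, 0 ≤ s → s ≤ δ →
      inner ℝ y (z₀ + s • v) = groupLasso 𝒥 (z₀ + s • v) := by
  have hy1 := forall_inner_le_groupLasso_iff.1 hy
  have hJ : ∀ J ∈ 𝒥.parts, ∃ δ > (0 : ℝ), ∀ s, 0 ≤ s → s ≤ δ →
      inner ℝ (subvector y J) (subvector z₀ J + s • subvector v J)
        = ‖subvector z₀ J + s • subvector v J‖ := by
    intro J hJ
    refine exists_pos_forall_inner_eq_norm (hy1 J hJ) (inner_subvector_eq_norm hy hz₀ hJ) ht ht0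
      (((continuous_subvector J).tendsto v).comp hw) (squeeze_zero (fun k => ?_) (fun k => ?_) hgap)
    · exact div_nonneg (sub_nonneg.2 (inner_le_norm_of_norm_le_one (hy1 J hJ) _)) (sq_nonneg _)
    · refine div_le_div_of_nonneg_right ?_ (sq_nonneg _)
      rw [groupLasso_sub_inner]
      exact Finset.single_le_sum (f := fun J => ‖subvector (z₀ + t k • w k) J‖ -
        inner ℝ (subvector y J) (subvector (z₀ + t k • w k) J)) (fun I hI => sub_nonneg.2
        (inner_le_norm_of_norm_le_one (hy1 I hI) _)) hJ
  choose! δ hδ hδs using hJ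
  obtain ⟨d, hd, hdδ⟩ : ∃ d > (0 : ℝ), ∀ J ∈ 𝒥.parts, d ≤ δ J := by
    have : ∀ᶠ d in 𝓝[>] (0 : ℝ), ∀ J ∈ 𝒥.parts, d ≤ δ J :=
      (Filter.eventually_all_finset _).2 fun J hJ =>
        (eventually_le_nhds (hδ J hJ)).filter_mono nhdsWithin_le_nhds
    obtain ⟨d, h1, h2⟩ := (this.and self_mem_nhdsWithin).exists
    exact ⟨d, h2, h1⟩
  refine ⟨d, hd, fun s hs hsd => ?_⟩
  rw [inner_eq_sum_subvector 𝒥, groupLasso]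
  exact Finset.sum_congr rfl fun J hJ => hδs J hJ s hs (hsd.trans (hdδ J hJ))

lemma mem_tangentCone_subdifferential_fenchelConjugate {y z₀ v : EuclideanSpace ℝ (Fin m)}
    (hy : ∀ u, inner ℝ y u ≤ groupLasso 𝒥 u) (hz₀ : inner ℝ y z₀ = groupLasso 𝒥 z₀) :
    v ∈ tangentCone (subdifferential (fenchelConjugate (groupLassoE 𝒥)) y) z₀ ↔
      ∃ δ > (0 : ℝ), ∀ s, 0 ≤ s → s ≤ δ →
        inner ℝ y (z₀ + s • v) = groupLasso 𝒥 (z₀ + s • v) := by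
  constructor
  · rintro ⟨t, w, ht, ht0, hw, hmem⟩
    refine exists_pos_forall_inner_eq_groupLasso hy hz₀ ht ht0 hw
      (tendsto_const_nhds.congr fun k => ?_)
    rw [(mem_subdifferential_fenchelConjugate hy).1 (hmem k), sub_self, zero_div]
  · rintro ⟨δ, hδ, h⟩
    refine ⟨fun k => δ * (1 / ((k : ℝ) + 1)), fun _ => v, fun k => by positivity, ?_,
      tendsto_const_nhds, fun k => (mem_subdifferential_fenchelConjugate hy).2
        (h _ (by positivity) ?_)⟩
    · simpa using tendsto_one_div_add_atTop_nhds_zero_nat.const_mul δ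
    · refine mul_le_of_le_one_right hδ.le ?_
      rw [div_le_one (by positivity)]
      linarith [k.cast_nonneg (α := ℝ)]

end Regularizer

/-! ### Growth, calmness and uniqueness for the least-squares problem -/

section LeastSquares

variable {X E : Type*} [NormedAddCommGroup X] [InnerProductSpace ℝ X] [FiniteDimensional ℝ X]
  [NormedAddCommGroup E] [InnerProductSpace ℝ E] [FiniteDimensional ℝ E] {m : ℕ}
  {𝒥 : Finpartition (Finset.univ : Finset (Fin m))}
  {Φ : X →ₗ[ℝ] E} {K : X →ₗ[ℝ] EuclideanSpace ℝ (Fin m)} {b₀ : E} {μ₀ : ℝ} {x₀ : X}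
  {y₀ : EuclideanSpace ℝ (Fin m)}

/-- Exact growth of the objective at a point `x₀` with dual certificate `y₀`. -/
lemma objective_eq_add (hμ₀ : 0 < μ₀) (hz₀ : inner ℝ y₀ (K x₀) = groupLasso 𝒥 (K x₀))
    (hKy₀ : LinearMap.adjoint K y₀ = -((1 / μ₀) • LinearMap.adjoint Φ (Φ x₀ - b₀))) (x : X) :
    objective Φ K 𝒥 b₀ μ₀ x = objective Φ K 𝒥 b₀ μ₀ x₀ + 1 / (2 * μ₀) * ‖Φ (x - x₀)‖ ^ 2
      + (groupLasso 𝒥 (K x) - inner ℝ y₀ (K x)) := by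
  have h1 : inner ℝ y₀ (K x) - inner ℝ y₀ (K x₀)
      = -(1 / μ₀ * inner ℝ (Φ x₀ - b₀) (Φ (x - x₀))) := by
    rw [← inner_sub_right, ← map_sub, ← LinearMap.adjoint_inner_left, hKy₀, inner_neg_left,
      real_inner_smul_left, LinearMap.adjoint_inner_left]
  have h2 : Φ x - b₀ = (Φ x₀ - b₀) + Φ (x - x₀) := by rw [map_sub]; abel
  simp only [objective]
  rw [h2, norm_add_sq_real, ← hz₀]
  have h3 : inner ℝ y₀ (K x) = inner ℝ y₀ (K x₀)
      - 1 / μ₀ * inner ℝ (Φ x₀ - b₀) (Φ (x - x₀)) := by linarith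
  rw [h3]
  field_simp
  ring

lemma isStrongSolution_of_inter_eq (hμ₀ : 0 < μ₀)
    (hx₀ : x₀ ∈ argmin (objective Φ K 𝒥 b₀ μ₀))
    (hy : ∀ u, inner ℝ y₀ u ≤ groupLasso 𝒥 u)
    (hz₀ : inner ℝ y₀ (K x₀) = groupLasso 𝒥 (K x₀))
    (hKy₀ : LinearMap.adjoint K y₀ = -((1 / μ₀) • LinearMap.adjoint Φ (Φ x₀ - b₀)))
    (h : (LinearMap.ker Φ : Set X) ∩ K ⁻¹' (tangentCone
      (subdifferential (fenchelConjugate (groupLassoE 𝒥)) y₀) (K x₀)) = {0}) :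
    IsStrongSolution (objective Φ K 𝒥 b₀ μ₀) x₀ := by
  refine ⟨hx₀, ?_⟩
  by_contra! hcon
  have hr : ∀ n : ℕ, (0 : ℝ) < 1 / ((n : ℝ) + 1) := fun n => by positivity
  -- Growth fails for `c = ε = 1/(n+1)`. Dividing the excess by `‖u n - x₀‖²` sends both nonnegative
  -- parts to zero, and a limit of the unit directions lies in the cone.
  choose u hu hFu using fun n : ℕ => hcon _ (hr n) _ (hr n)
  have hsmall : Tendsto (fun n : ℕ => 1 / ((n : ℝ) + 1)) atTop (𝓝 0) :=
    tendsto_one_div_add_atTop_nhds_zero_nat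
  set t : ℕ → ℝ := fun n => ‖u n - x₀‖ with ht_def
  have htpos : ∀ n, 0 < t n := by
    intro n
    refine norm_pos_iff.2 fun h0 => ?_
    have := hFu n
    rw [h0, sub_eq_zero.1 h0] at this
    simp at this
  have ht0 : Tendsto t atTop (𝓝 0) :=
    squeeze_zero (fun n => norm_nonneg _) (fun n => (mem_ball_iff_norm.1 (hu n)).le) hsmall
  set w : ℕ → X := fun n => (t n)⁻¹ • (u n - x₀) with hw_def
  have hut : ∀ n, u n - x₀ = t n • w n := fun n => by
    rw [hw_def, smul_inv_smul₀ (htpos n).ne']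
  have hw1 : ∀ n, w n ∈ Metric.sphere (0 : X) 1 := fun n => by
    rw [mem_sphere_zero_iff_norm, hw_def, norm_smul, norm_inv, Real.norm_of_nonneg (htpos n).le]
    exact inv_mul_cancel₀ (htpos n).ne'
  have hbound : ∀ n, 1 / (2 * μ₀) * ‖Φ (w n)‖ ^ 2
      + (groupLasso 𝒥 (K (u n)) - inner ℝ y₀ (K (u n))) / t n ^ 2 ≤ 1 / ((n : ℝ) + 1) := by
    intro n
    have h1 := hFu n
    rw [objective_eq_add hμ₀ hz₀ hKy₀ (u n), hut, map_smul, norm_smul, norm_smul,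
      mem_sphere_zero_iff_norm.1 (hw1 n), Real.norm_of_nonneg (htpos n).le] at h1
    have htn := htpos n
    rw [← sub_nonneg]
    have h2 : 0 ≤ (1 / ((n : ℝ) + 1) * t n ^ 2 - 1 / (2 * μ₀) * ‖Φ (w n)‖ ^ 2 * t n ^ 2
        - (groupLasso 𝒥 (K (u n)) - inner ℝ y₀ (K (u n)))) / t n ^ 2 := by
      refine div_nonneg ?_ (sq_nonneg _)
      nlinarith [mul_nonneg (hr n).le (sq_nonneg (t n))]
    convert h2 using 1
    field_simp
    ring
  have hgap0 : ∀ n, 0 ≤ (groupLasso 𝒥 (K (u n)) - inner ℝ y₀ (K (u n))) / t n ^ 2 :=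
    fun n => div_nonneg (sub_nonneg.2 (hy _)) (sq_nonneg _)
  have hΦ0 : ∀ n, 0 ≤ 1 / (2 * μ₀) * ‖Φ (w n)‖ ^ 2 := fun n => by positivity
  obtain ⟨v, hv, φ, hφ, hwv⟩ := (isCompact_sphere (0 : X) 1).tendsto_subseq hw1
  have hΦc : Continuous Φ := Φ.continuous_of_finiteDimensional
  have hKc : Continuous K := K.continuous_of_finiteDimensional
  have hΦv : Φ v = 0 := by
    have h1 : Tendsto (fun n => 1 / (2 * μ₀) * ‖Φ (w n)‖ ^ 2) atTop (𝓝 0) :=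
      squeeze_zero hΦ0 (fun n => by linarith [hbound n, hgap0 n]) hsmall
    have h2 := tendsto_nhds_unique (h1.comp hφ.tendsto_atTop)
      ((((hΦc.tendsto v).comp hwv).norm.pow 2).const_mul (1 / (2 * μ₀)))
    simpa [hμ₀.ne'] using h2.symm
  have hKv : K v ∈ tangentCone
      (subdifferential (fenchelConjugate (groupLassoE 𝒥)) y₀) (K x₀) := by
    rw [mem_tangentCone_subdifferential_fenchelConjugate hy hz₀]
    refine exists_pos_forall_inner_eq_groupLasso (t := t ∘ φ) (w := fun k => K (w (φ k))) hy hz₀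
      (fun k => htpos _) (ht0.comp hφ.tendsto_atTop) ((hKc.tendsto v).comp hwv) ?_
    have h1 : Tendsto (fun n => (groupLasso 𝒥 (K (u n)) - inner ℝ y₀ (K (u n))) / t n ^ 2)
        atTop (𝓝 0) :=
      squeeze_zero hgap0 (fun n => by linarith [hbound n, hΦ0 n]) hsmall
    refine (h1.comp hφ.tendsto_atTop).congr fun k => ?_
    have h2 : K (u (φ k)) = K x₀ + t (φ k) • K (w (φ k)) := by
      rw [← map_smul, ← hut, ← map_add, add_sub_cancel]
    simp only [Function.comp, h2]
  have hv0 : v ∈ ({0} : Set X) := h ▸ ⟨hΦv, hKv⟩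
  rw [Set.mem_singleton_iff.1 hv0] at hv
  simp at hv

lemma isolatedCalmAt_of_isStrongSolution (hμ₀ : 0 < μ₀)
    (hy₀ : y₀ ∈ subdifferential (groupLassoE 𝒥) (K x₀))
    (hKy₀ : LinearMap.adjoint K y₀ = -((1 / μ₀) • LinearMap.adjoint Φ (Φ x₀ - b₀)))
    (h : IsStrongSolution (objective Φ K 𝒥 b₀ μ₀) x₀) :
    IsolatedCalmAt (solutionMap Φ K 𝒥) b₀ μ₀ x₀ := by
  obtain ⟨hy, hz₀⟩ := mem_subdifferential_groupLassoE.1 hy₀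
  obtain ⟨-, c, hc, ε, hε, hgrow⟩ := h
  refine ⟨⟨y₀, hy₀, by rw [hKy₀, add_neg_cancel]⟩, ?_⟩
  set M : ℝ := ‖LinearMap.toContinuousLinearMap Φ‖
  have hM : ∀ x, ‖Φ x‖ ≤ M * ‖x‖ := (LinearMap.toContinuousLinearMap Φ).le_opNorm
  have hM0 : 0 ≤ M := norm_nonneg _
  set R : ℝ := ‖Φ x₀ - b₀‖ / μ₀ with hR
  have hR0 : 0 ≤ R := by positivity
  -- The summand `1` only keeps the modulus positive. The bound `μ < 2μ₀` lets `‖Φ d‖²` absorb the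
  -- quadratic term of the growth estimate; `μ > μ₀/2` keeps its left side at least `μ₀ c/4 ‖d‖²`.
  refine ⟨4 / (μ₀ * c) * (M * (1 + R)) + 1, by positivity, Metric.ball x₀ ε,
    Metric.ball_mem_nhds _ hε, Set.univ, univ_mem, Set.Ioo (μ₀ / 2) (2 * μ₀),
    Ioo_mem_nhds (by linarith) (by linarith), ?_⟩
  rintro b - μ ⟨hμ1, hμ2⟩ hμ x ⟨⟨y, hyx, hxy⟩, hxU⟩
  obtain ⟨hy', hz⟩ := mem_subdifferential_groupLassoE.1 hyx
  have hg := hgrow x hxU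
  rw [objective_eq_add hμ₀ hz₀ hKy₀ x] at hg
  set d := x - x₀ with hd
  set D := groupLasso 𝒥 (K x) - inner ℝ y₀ (K x) with hD
  set A := ‖b - b₀‖ + |μ - μ₀| with hA
  have hA0 : 0 ≤ A := by positivity
  have hmono : D ≤ inner ℝ y (K d) - inner ℝ y₀ (K d) := by
    rw [hd, map_sub, inner_sub_right, inner_sub_right, hz, hz₀]
    linarith [hy' (K x₀)]
  have e1 : inner ℝ y₀ (K d) = -(1 / μ₀ * inner ℝ (Φ x₀ - b₀) (Φ d)) := by
    rw [← LinearMap.adjoint_inner_left, hKy₀, inner_neg_left,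
      real_inner_smul_left, LinearMap.adjoint_inner_left]
  have e2 : inner ℝ y (K d) = -(1 / μ * inner ℝ (Φ x - b) (Φ d)) := by
    rw [← LinearMap.adjoint_inner_left, eq_neg_of_add_eq_zero_right hxy, inner_neg_left,
      real_inner_smul_left, LinearMap.adjoint_inner_left]
  have e3 : inner ℝ (Φ x - b) (Φ d)
      = ‖Φ d‖ ^ 2 + inner ℝ (Φ x₀ - b₀) (Φ d) - inner ℝ (b - b₀) (Φ d) := by
    rw [← real_inner_self_eq_norm_sq, ← inner_add_left, ← inner_sub_left, hd, map_sub]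
    congr 1
    abel
  have e4 : μ * D ≤ -‖Φ d‖ ^ 2 + inner ℝ (b - b₀) (Φ d)
      + (μ - μ₀) / μ₀ * inner ℝ (Φ x₀ - b₀) (Φ d) := by
    refine (mul_le_mul_of_nonneg_left hmono hμ.le).trans_eq ?_
    rw [e1, e2, e3]
    field_simp
    ring
  have e5 : inner ℝ (b - b₀) (Φ d) ≤ ‖b - b₀‖ * ‖Φ d‖ := real_inner_le_norm _ _
  have e6 : (μ - μ₀) / μ₀ * inner ℝ (Φ x₀ - b₀) (Φ d) ≤ |μ - μ₀| * R * ‖Φ d‖ := by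
    refine (le_abs_self _).trans ?_
    rw [abs_mul, abs_div, abs_of_pos hμ₀]
    refine (mul_le_mul_of_nonneg_left (abs_real_inner_le_norm _ _) (by positivity)).trans_eq ?_
    rw [hR]
    ring
  have e7 : ‖b - b₀‖ * ‖Φ d‖ + |μ - μ₀| * R * ‖Φ d‖ ≤ A * (1 + R) * (M * ‖d‖) := by
    rw [← add_mul]
    refine mul_le_mul ?_ (hM d) (norm_nonneg _) (by positivity)
    rw [hA]
    nlinarith [norm_nonneg (b - b₀), abs_nonneg (μ - μ₀),
      mul_nonneg (norm_nonneg (b - b₀)) hR0]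
  have e8 : μ * (c / 2 * ‖d‖ ^ 2) ≤ ‖Φ d‖ ^ 2 + μ * D := by
    have h1 : c / 2 * ‖d‖ ^ 2 ≤ 1 / (2 * μ₀) * ‖Φ d‖ ^ 2 + D := by linarith
    have h2 := mul_le_mul_of_nonneg_left h1 hμ.le
    have h3 : μ * (1 / (2 * μ₀)) ≤ 1 := by
      rw [mul_one_div, div_le_one (by positivity)]
      exact hμ2.le
    nlinarith [mul_le_mul_of_nonneg_right h3 (sq_nonneg ‖Φ d‖)]
  have e9 : μ₀ * c / 4 * ‖d‖ ^ 2 ≤ A * (1 + R) * (M * ‖d‖) := by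
    have h1 : μ₀ / 2 * (c / 2 * ‖d‖ ^ 2) ≤ μ * (c / 2 * ‖d‖ ^ 2) :=
      mul_le_mul_of_nonneg_right hμ1.le (by positivity)
    nlinarith
  have e10 : ‖d‖ ≤ 4 / (μ₀ * c) * (M * (1 + R)) * A := by
    rcases (norm_nonneg d).eq_or_lt with h0 | h0
    · rw [← h0]
      positivity
    · have h1 : μ₀ * c / 4 * ‖d‖ ≤ A * (1 + R) * M := by
        refine le_of_mul_le_mul_right ?_ h0
        linarith
      have h2 : 4 / (μ₀ * c) * (M * (1 + R)) * A = A * (1 + R) * M / (μ₀ * c / 4) := by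
        field_simp
      rw [h2, le_div_iff₀ (by positivity)]
      linarith
  linarith

lemma argmin_eq_of_isolatedCalmAt (hμ₀ : 0 < μ₀)
    (hx₀ : x₀ ∈ argmin (objective Φ K 𝒥 b₀ μ₀))
    (hy₀ : y₀ ∈ subdifferential (groupLassoE 𝒥) (K x₀))
    (hKy₀ : LinearMap.adjoint K y₀ = -((1 / μ₀) • LinearMap.adjoint Φ (Φ x₀ - b₀)))
    (h : IsolatedCalmAt (solutionMap Φ K 𝒥) b₀ μ₀ x₀) :
    argmin (objective Φ K 𝒥 b₀ μ₀) = {x₀} := by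
  obtain ⟨hy, hz₀⟩ := mem_subdifferential_groupLassoE.1 hy₀
  obtain ⟨-, κ, -, U, hU, V, hV, W, hW, hcalm⟩ := h
  refine Set.eq_singleton_iff_unique_mem.2 ⟨hx₀, fun x hx => ?_⟩
  have hF := objective_eq_add hμ₀ hz₀ hKy₀ x
  have h1 : 0 ≤ 1 / (2 * μ₀) * ‖Φ (x - x₀)‖ ^ 2 := by positivity
  have h2 := hy (K x)
  have h3 := hx x₀
  have hΦ : Φ (x - x₀) = 0 := by
    have : 1 / (2 * μ₀) * ‖Φ (x - x₀)‖ ^ 2 = 0 := by linarith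
    simpa [hμ₀.ne'] using this
  have hKx : inner ℝ y₀ (K x) = groupLasso 𝒥 (K x) := by linarith
  have hcont : Tendsto (fun s : ℝ => x₀ + s • (x - x₀)) (𝓝[>] 0) (𝓝 x₀) := by
    refine Tendsto.mono_left ?_ nhdsWithin_le_nhds
    have : Continuous fun s : ℝ => x₀ + s • (x - x₀) := by fun_prop
    simpa using this.tendsto 0
  obtain ⟨s, ⟨hsU, hs1⟩, hs0⟩ := (((hcont.eventually hU).and
    ((eventually_le_nhds one_pos).filter_mono nhdsWithin_le_nhds)).and
      self_mem_nhdsWithin).exists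
  replace hs0 : 0 < s := hs0
  have hKs : K (x₀ + s • (x - x₀)) = (1 - s) • K x₀ + s • K x := by
    rw [map_add, map_smul, map_sub]
    module
  -- The same `y₀` certifies the segment from `x₀` to another minimizer, so calmness at the
  -- unperturbed parameters forces `x = x₀`.
  have hmem : x₀ + s • (x - x₀) ∈ solutionMap Φ K 𝒥 b₀ μ₀ := by
    refine ⟨y₀, mem_subdifferential_groupLassoE.2 ⟨hy, le_antisymm (hy _) ?_⟩, ?_⟩
    · rw [hKs]
      refine (groupLasso_add_le _ _).trans_eq ?_
      rw [groupLasso_smul (sub_nonneg.2 hs1), groupLasso_smul hs0.le, inner_add_right,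
        inner_smul_right, inner_smul_right, hz₀, hKx]
    · rw [map_add, map_smul, hΦ, smul_zero, add_zero, hKy₀, add_neg_cancel]
  have h4 := hcalm b₀ (mem_of_mem_nhds hV) μ₀ (mem_of_mem_nhds hW) hμ₀ _ ⟨hmem, hsU⟩
  simp only [add_sub_cancel_left, sub_self, norm_zero, abs_zero, add_zero, mul_zero,
    norm_le_zero_iff, smul_eq_zero, hs0.ne', false_or] at h4
  exact sub_eq_zero.1 h4

/-- A direction in the cone is feasible for the zero set of the gap and killed by `Φ`, so a short
step along it yields another minimizer. -/
lemma inter_eq_of_argmin_eq (hμ₀ : 0 < μ₀)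
    (hy : ∀ u, inner ℝ y₀ u ≤ groupLasso 𝒥 u)
    (hz₀ : inner ℝ y₀ (K x₀) = groupLasso 𝒥 (K x₀))
    (hKy₀ : LinearMap.adjoint K y₀ = -((1 / μ₀) • LinearMap.adjoint Φ (Φ x₀ - b₀)))
    (h : argmin (objective Φ K 𝒥 b₀ μ₀) = {x₀}) :
    (LinearMap.ker Φ : Set X) ∩ K ⁻¹' (tangentCone
      (subdifferential (fenchelConjugate (groupLassoE 𝒥)) y₀) (K x₀)) = {0} := by
  refine Set.eq_singleton_iff_unique_mem.2 ⟨⟨map_zero Φ, ?_⟩, ?_⟩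
  · rw [Set.mem_preimage, mem_tangentCone_subdifferential_fenchelConjugate hy hz₀]
    exact ⟨1, one_pos, fun s _ _ => by simpa using hz₀⟩
  · rintro w ⟨hΦw, hKw⟩
    replace hΦw : Φ w = 0 := hΦw
    rw [Set.mem_preimage, mem_tangentCone_subdifferential_fenchelConjugate hy hz₀] at hKw
    obtain ⟨δ, hδ, hs⟩ := hKw
    have h1 := hs δ hδ.le le_rfl
    rw [← map_smul, ← map_add] at h1
    have hx₀ : x₀ ∈ argmin (objective Φ K 𝒥 b₀ μ₀) := h ▸ Set.mem_singleton x₀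
    have hF : objective Φ K 𝒥 b₀ μ₀ (x₀ + δ • w) = objective Φ K 𝒥 b₀ μ₀ x₀ := by
      rw [objective_eq_add hμ₀ hz₀ hKy₀, h1, add_sub_cancel_left, map_smul, hΦw]
      simp
    have hmem : x₀ + δ • w ∈ argmin (objective Φ K 𝒥 b₀ μ₀) := fun u => hF ▸ hx₀ u
    rw [h, Set.mem_singleton_iff] at hmem
    simpa [hδ.ne'] using hmem

end LeastSquares

end GroupLasso

theorem corollary4p5 {X E : Type*}
    [NormedAddCommGroup X] [InnerProductSpace ℝ X] [FiniteDimensional ℝ X]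
    [NormedAddCommGroup E] [InnerProductSpace ℝ E] [FiniteDimensional ℝ E]
    {m : ℕ} (𝒥 : Finpartition (Finset.univ : Finset (Fin m)))
    (Φ : X →ₗ[ℝ] E) (K : X →ₗ[ℝ] EuclideanSpace ℝ (Fin m))
    (b₀ : E) (μ₀ : ℝ) (hμ₀ : 0 < μ₀)
    (x₀ : X) (hx₀ : x₀ ∈ GroupLasso.argmin (GroupLasso.objective Φ K 𝒥 b₀ μ₀))
    (y₀ : EuclideanSpace ℝ (Fin m))
    (hy₀ : y₀ ∈ GroupLasso.subdifferential (GroupLasso.groupLassoE 𝒥) (K x₀))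
    (hKy₀ : LinearMap.adjoint K y₀ = -((1 / μ₀) • LinearMap.adjoint Φ (Φ x₀ - b₀))) :
    List.TFAE [
      GroupLasso.IsolatedCalmAt (GroupLasso.solutionMap Φ K 𝒥) b₀ μ₀ x₀,
      GroupLasso.argmin (GroupLasso.objective Φ K 𝒥 b₀ μ₀) = {x₀},
      GroupLasso.IsStrongSolution (GroupLasso.objective Φ K 𝒥 b₀ μ₀) x₀,
      (LinearMap.ker Φ : Set X) ∩ K ⁻¹' (GroupLasso.tangentCone
        (GroupLasso.subdifferential
          (GroupLasso.fenchelConjugate (GroupLasso.groupLassoE 𝒥)) y₀) (K x₀)) = {0}] := by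
  obtain ⟨hy, hz₀⟩ := GroupLasso.mem_subdifferential_groupLassoE.1 hy₀
  tfae_have 1 → 2 := GroupLasso.argmin_eq_of_isolatedCalmAt hμ₀ hx₀ hy₀ hKy₀
  tfae_have 2 → 4 := GroupLasso.inter_eq_of_argmin_eq hμ₀ hy hz₀ hKy₀
  tfae_have 4 → 3 := GroupLasso.isStrongSolution_of_inter_eq hμ₀ hx₀ hy hz₀ hKy₀
  tfae_have 3 → 1 := GroupLasso.isolatedCalmAt_of_isStrongSolution hμ₀ hy₀ hKy₀
  tfae_finish
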